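/- Let $G,\Gamma$ be a matched pair of groups: groups with left actions $\rhd_1$ of $G$ on the set $\Gamma$ and $\rhd_2$ of $\Gamma$ on the set $G$ such that $g\rhd_1 e=e$, $s\rhd_2 e=e$, $g\rhd_1(st)=((t\rhd_2 g)\rhd_1 s)(g\rhd_1 t)$ and $s\rhd_2(gh)=((h\rhd_1 s)\rhd_2 g)(s\rhd_2 h)$. Let $\mathcal C$ be a $(G,\Gamma)$-crossed monoidal category in the sense of Natale. That is, $\mathcal C$ is an additive monoidal category (with biadditive $\otimes$, associator $a$, unitors $l,r$) with the following structure. - A $\Gamma$-grading $\mathcal C=\bigoplus_{s\in\Gamma}\mathcal C_s$ by full, isomorphism-closed additive subcategories with $\mathcal C_s\otimes\mathcal C_t\subset\mathcal C_{st}$; here the direct sum means that there are no nonzero morphisms between $\mathcal C_s$ and $\mathcal C_t$ for $s\ne t$ and that every object is a finite direct sum of homogeneous objects, i.e. of objects of the $\mathcal C_s$. - An action of $G$ on the category $\mathcal C$ by additive endofunctors $\gamma(g)$, written ${}^g(-)$, with natural isomorphisms $\chi_{g,h}:\gamma(g)\gamma(h)\cong\gamma(gh)$ and $\iota:\mathrm{id}\cong\gamma(e)$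 satisfying the associativity and unit relations of a monoidal functor. One requires ${}^g\mathcal C_s\subset\mathcal C_{g\rhd_1 s}$. - Isomorphisms $J^{g}_{\lambda,\mu}:{}^{s\rhd_2 g}\lambda\otimes{}^g\mu\cong{}^g(\lambda\otimes\mu)$ for $g\in G$, $s\in\Gamma$, $\lambda\in\mathcal C$, $\mu\in\mathcal C_s$, natural in $\lambda$ and $\mu$, and isomorphisms $\varphi^g:\mathbf 1\cong{}^g\mathbf 1$. These satisfy, for all $g,h\in G$, $\lambda\in\mathcal C$, $\mu\in\mathcal C_s$, $\nu\in\mathcal C_t$ (note that $\mathbf 1\in\mathcal C_e$ automatically), $$\begin{aligned} {}^g a_{\lambda,\mu,\nu}\,J^g_{\lambda\otimes\mu,\nu}\,(J^{t\rhd_2 g}_{\lambda,\mu}\otimes\mathrm{id})&=J^g_{\lambda,\mu\otimes\nu}\,(\mathrm{id}\otimes J^g_{\mu,\nu})\,a,\\ {}^g l_\mu\,J^g_{\mathbf 1,\mu}\,(\varphi^{s\rhd_2 g}\otimes\mathrm{id})&=l_{{}^g\mu},\\ {}^g r_\lambda\,J^g_{\lambda,\mathbf 1}\,(\mathrm{id}\otimes\varphi^g)&=r_{{}^g\lambda},\\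 (\chi_{g,h})_{\lambda\otimes\mu}\,{}^gJ^h_{\lambda,\mu}\,J^g_{{}^{s\rhd_2 h}\lambda,{}^h\mu}&=J^{gh}_{\lambda,\mu}\,\big((\chi_{(h\rhd_1 s)\rhd_2 g,\;s\rhd_2 h})_\lambda\otimes(\chi_{g,h})_\mu\big),\\ (\chi_{g,h})_{\mathbf 1}\,{}^g\varphi^h\,\varphi^g&=\varphi^{gh},\\ \iota_{\lambda\otimes\mu}&=J^e_{\lambda,\mu}\,(\iota_\lambda\otimes\iota_\mu),\qquad \iota_{\mathbf 1}=\varphi^e. \end{aligned}$$ For $n\ge 0$ let $W_n$ be the set of formal $n$-ary words, i.e. formal composites with $n$ inputs of the nullary symbol $\mathbf 1$, the unary symbols $-$ and $\gamma(g)$ $(g\in G)$ and the binary symbol $\otimes$ (so each of the $n$ variables occurs exactly once, in order). A word $w\in W_n$ has a value $w(\lambda_1,\dots,\lambda_n)\in\mathcal C$ on objects $\lambda_1,\dots,\lambda_n$ of $\mathcal C$. Fix such objects $\lambda=(\lambda_i)_i$. The canonical morphisms $w(\lambda)\to w'(\lambda)$, for formal words $w,w'$ in the variables $1,\dots,n$,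 are those generated as follows. The components of $a$, $l$, $r$, $\chi_{g,h}$, $\iota$, $\varphi^g$ at values of words are canonical, regarded as morphisms between the evident words. So are the components $J^g_{u(\lambda),v(\lambda)}$ for words $u,v$ with $v(\lambda)\in\mathcal C_s$, regarded as morphisms from the word $\gamma(s\rhd_2 g)(u)\otimes\gamma(g)(v)$ to the word $\gamma(g)(u\otimes v)$. Identities, inverses of canonical morphisms, composites of canonical morphisms $w(\lambda)\to w'(\lambda)\to w''(\lambda)$ along a common intermediate formal word $w'$, tensor products of canonical morphisms, and images of canonical morphisms under the functors $\gamma(g)$ are canonical. Then for all $n\ge 0$, all $w,w'\in W_n$ and all objects $\lambda_1,\dots,\lambda_n$ of $\mathcal C$, any two canonical morphisms $w(\lambda_1,\dots,\lambda_n)\to w'(\lambda_1,\dots,\lambda_n)$ are equal. -/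

import Mathlib

open CategoryTheory MonoidalCategory Limits

universe v u

namespace CrossedCoherence

/-- A matched pair of groups `(G, Γ)`: `lact g s` is `g ▷₁ s` and `ract s g` is `s ▷₂ g`.
Both are left actions on the underlying sets. -/
structure MatchedPair (G Γ : Type*) [Group G] [Group Γ] where
  lact : G → Γ → Γ
  ract : Γ → G → G
  one_lact : ∀ s, lact 1 s = s
  mul_lact : ∀ g h s, lact (g * h) s = lact g (lact h s)
  one_ract : ∀ g, ract 1 g = g
  mul_ract : ∀ s t g, ract (s * t) g = ract s (ract t g)
  lact_one : ∀ g, lact g 1 = 1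
  ract_one : ∀ s, ract s 1 = 1
  lact_mul : ∀ g s t, lact g (s * t) = lact (ract t g) s * lact g t
  ract_mul : ∀ s g h, ract s (g * h) = ract (lact h s) g * ract s h

/-- A grading of an additive category `C` by a set `Γ`: full, replete additive subcategories
`C_s` (given by their objects; `mem s X` says that `X` is an object of `C_s`), orthogonal to
each other, such that every object is a finite direct sum of homogeneous objects. -/
structure Grading (Γ : Type*) (C : Type u) [Category.{v} C] [Preadditive C]
    [HasFiniteBiproducts C] where
  mem : Γ → C → Prop
  mem_of_iso : ∀ {s : Γ} {X Y : C}, (X ≅ Y) → mem s X → mem s Y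
  mem_biproduct : ∀ {s : Γ} {n : ℕ} (Y : Fin n → C), (∀ i, mem s (Y i)) → mem s (⨁ Y)
  hom_eq_zero : ∀ {s t : Γ} {X Y : C}, s ≠ t → mem s X → mem t Y → ∀ f : X ⟶ Y, f = 0
  exists_decomposition : ∀ X : C, ∃ (n : ℕ) (d : Fin n → Γ) (Y : Fin n → C),
    (∀ i, mem (d i) (Y i)) ∧ Nonempty (X ≅ ⨁ Y)

/-- A `Γ`-graded monoidal category: an additive monoidal category with a `Γ`-grading such that
`C_s ⊗ C_t ⊆ C_{st}`. -/
structure MonoidalGrading (Γ : Type*) [Group Γ] (C : Type u) [Category.{v} C] [Preadditive C]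
    [HasFiniteBiproducts C] [MonoidalCategory C] [MonoidalPreadditive C]
    extends Grading Γ C where
  mem_tensor : ∀ {s t : Γ} {X Y : C}, mem s X → mem t Y → mem (s * t) (X ⊗ Y)

section

variable {C : Type u} [Category.{v} C] [Preadditive C] [HasFiniteBiproducts C]

theorem Grading.mem_of_isZero {Γ : Type*} (P : Grading Γ C) (s : Γ) {X : C} (hX : IsZero X) :
    P.mem s X := by
  obtain ⟨n, d, Y, -, ⟨e⟩⟩ := P.exists_decomposition X
  have hY : ∀ i : Fin 0, P.mem s ((fun i : Fin 0 => i.elim0) i : C) := fun i => i.elim0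
  refine P.mem_of_iso (IsZero.iso ?_ hX) (P.mem_biproduct _ hY)
  rw [IsZero.iff_id_eq_zero]
  ext i
  exact i.elim0

/-- The unit object of a graded monoidal category automatically has trivial degree. -/
theorem MonoidalGrading.mem_unit [MonoidalCategory C] [MonoidalPreadditive C]
    {Γ : Type*} [Group Γ] (P : MonoidalGrading Γ C) : P.mem 1 (𝟙_ C) := by
  obtain ⟨n, d, Y, hY, ⟨e⟩⟩ := P.exists_decomposition (𝟙_ C)
  refine P.mem_of_iso e.symm (P.mem_biproduct Y fun i => ?_)
  by_cases hi : d i = 1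
  · exact hi ▸ hY i
  apply P.mem_of_isZero
  -- the summand `Y i ⊗ Y j` of `𝟙_ C ⊗ Y j ≅ Y j` vanishes for degree reasons
  have key : ∀ j, 𝟙 (Y i ⊗ Y j) = 0 := by
    intro j
    have hne : d i * d j ≠ d j := fun h => hi (by simpa using h)
    have h0 := P.hom_eq_zero hne (P.mem_tensor (hY i) (hY j)) (hY j)
      (((biproduct.ι Y i ≫ e.inv) ▷ Y j) ≫ (λ_ (Y j)).hom)
    have : 𝟙 (Y i ⊗ Y j) = (((biproduct.ι Y i ≫ e.inv) ▷ Y j) ≫ (λ_ (Y j)).hom) ≫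
        (λ_ (Y j)).inv ≫ ((e.hom ≫ biproduct.π Y i) ▷ Y j) := by
      simp only [Category.assoc, Iso.hom_inv_id_assoc, ← comp_whiskerRight]
      simp
    rw [this, h0, zero_comp]
  have hid : 𝟙 (Y i ⊗ 𝟙_ C) = 0 := by
    have h1 : 𝟙 (𝟙_ C) = ∑ j, e.hom ≫ biproduct.π Y j ≫ biproduct.ι Y j ≫ e.inv := by
      have h2 : 𝟙 (𝟙_ C) = e.hom ≫ (∑ j, biproduct.π Y j ≫ biproduct.ι Y j) ≫ e.inv := by
        rw [biproduct.total]; simp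
      rw [h2, Preadditive.sum_comp, Preadditive.comp_sum]
      simp
    rw [← whiskerLeft_id, h1, whiskerLeft_sum]
    refine Finset.sum_eq_zero fun j _ => ?_
    have : Y i ◁ (e.hom ≫ biproduct.π Y j ≫ biproduct.ι Y j ≫ e.inv) =
        (Y i ◁ (e.hom ≫ biproduct.π Y j)) ≫ 𝟙 (Y i ⊗ Y j) ≫
          (Y i ◁ (biproduct.ι Y j ≫ e.inv)) := by
      simp
    rw [this, key j]
    simp
  exact IsZero.of_iso ((IsZero.iff_id_eq_zero _).2 hid) (ρ_ (Y i)).symm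

end

/-- An action of a group `G` on an additive category `C` by additive endofunctors `γ g`, with
natural isomorphisms `χ g h : γ g ∘ γ h ≅ γ (g h)` and `ι : id ≅ γ 1` satisfying the coherence
relations of a monoidal functor from the discrete monoidal category on `G` to the monoidal
category of additive endofunctors (with composition as tensor product). -/
structure GroupAction (G : Type*) [Group G] (C : Type u) [Category.{v} C] [Preadditive C] where
  γ : G → C ⥤ C
  additive : ∀ g, (γ g).Additive
  χ : ∀ (g h : G) (X : C), (γ g).obj ((γ h).obj X) ≅ (γ (g * h)).obj X
  χ_naturality : ∀ (g h : G) {X Y : C} (f : X ⟶ Y),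
    (γ g).map ((γ h).map f) ≫ (χ g h Y).hom = (χ g h X).hom ≫ (γ (g * h)).map f
  ι : ∀ X : C, X ≅ (γ 1).obj X
  ι_naturality : ∀ {X Y : C} (f : X ⟶ Y), f ≫ (ι Y).hom = (ι X).hom ≫ (γ 1).map f
  χ_assoc : ∀ (g h k : G) (X : C),
    (χ g h ((γ k).obj X)).hom ≫ (χ (g * h) k X).hom =
      (γ g).map (χ h k X).hom ≫ (χ g (h * k) X).hom ≫
        eqToHom (congrArg (fun l => (γ l).obj X) (mul_assoc g h k).symm)
  ι_χ : ∀ (g : G) (X : C),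
    (ι ((γ g).obj X)).hom ≫ (χ 1 g X).hom =
      eqToHom (congrArg (fun l => (γ l).obj X) (one_mul g).symm)
  map_ι_χ : ∀ (g : G) (X : C),
    (γ g).map (ι X).hom ≫ (χ g 1 X).hom =
      eqToHom (congrArg (fun l => (γ l).obj X) (mul_one g).symm)

/-- The identification `γ g X = γ h X` for `g = h`, as an isomorphism. -/
def GroupAction.congr {G : Type*} [Group G] {C : Type u} [Category.{v} C] [Preadditive C]
    (A : GroupAction G C) {g h : G} (e : g = h) (X : C) : (A.γ g).obj X ≅ (A.γ h).obj X :=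
  eqToIso (congrArg (fun l => (A.γ l).obj X) e)

/-- A `(G, Γ)`-crossed monoidal category (in the sense of Natale), as a structure on an additive
monoidal category `C`. The isomorphism `J g s X Y hY` is the component at `(X, Y)` of `J^{γ(g)}`
for `Y` an object of `C_s`; the canonical identifications of the type `γ g = γ g'` for
`g = g'`, given by `act.congr`, hold by the laws of a matched pair. -/
structure CrossedStructure {G Γ : Type*} [Group G] [Group Γ] (M : MatchedPair G Γ)
    (C : Type u) [Category.{v} C] [Preadditive C] [HasFiniteBiproducts C]
    [MonoidalCategory C] [MonoidalPreadditive C] where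
  grading : MonoidalGrading Γ C
  act : GroupAction G C
  J : ∀ (g : G) (s : Γ) (X Y : C), grading.mem s Y →
    ((act.γ (M.ract s g)).obj X ⊗ (act.γ g).obj Y ≅ (act.γ g).obj (X ⊗ Y))
  J_naturality : ∀ (g : G) (s : Γ) {X X' Y Y' : C} (hY : grading.mem s Y)
    (hY' : grading.mem s Y') (f : X ⟶ X') (f' : Y ⟶ Y'),
    ((act.γ (M.ract s g)).map f ⊗ₘ (act.γ g).map f') ≫ (J g s X' Y' hY').hom =
      (J g s X Y hY).hom ≫ (act.γ g).map (f ⊗ₘ f')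
  φ : ∀ g : G, 𝟙_ C ≅ (act.γ g).obj (𝟙_ C)
  /-- Axiom on degrees. -/
  mem_act : ∀ (g : G) {s : Γ} {X : C}, grading.mem s X →
    grading.mem (M.lact g s) ((act.γ g).obj X)
  /-- Compatibility of `J` with the associator. -/
  J_assoc : ∀ (g : G) (s t : Γ) (X Y Z : C) (hY : grading.mem s Y) (hZ : grading.mem t Z),
    ((J (M.ract t g) s X Y hY).hom ▷ (act.γ g).obj Z) ≫ (J g t (X ⊗ Y) Z hZ).hom ≫
        (act.γ g).map (α_ X Y Z).hom =
      (α_ _ _ _).hom ≫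
        ((act.congr (M.mul_ract s t g).symm X).hom ⊗ₘ (J g t Y Z hZ).hom) ≫
        (J g (s * t) X (Y ⊗ Z) (grading.mem_tensor hY hZ)).hom
  /-- Compatibility of `J` and `φ` with the left unitor. -/
  J_unit_left : ∀ (g : G) (s : Γ) (Y : C) (hY : grading.mem s Y),
    ((φ (M.ract s g)).hom ▷ (act.γ g).obj Y) ≫ (J g s (𝟙_ C) Y hY).hom ≫
        (act.γ g).map (λ_ Y).hom =
      (λ_ ((act.γ g).obj Y)).hom
  /-- Compatibility of `J` and `φ` with the right unitor. -/
  J_unit_right : ∀ (g : G) (X : C),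
    ((act.congr (M.one_ract g).symm X).hom ⊗ₘ (φ g).hom) ≫
        (J g 1 X (𝟙_ C) grading.mem_unit).hom ≫ (act.γ g).map (ρ_ X).hom =
      (ρ_ ((act.γ g).obj X)).hom
  /-- Compatibility of `J` with `χ`. -/
  J_χ : ∀ (g h : G) (s : Γ) (X Y : C) (hY : grading.mem s Y),
    (J g (M.lact h s) ((act.γ (M.ract s h)).obj X) ((act.γ h).obj Y) (mem_act h hY)).hom ≫
        (act.γ g).map (J h s X Y hY).hom ≫ (act.χ g h (X ⊗ Y)).hom =
      (((act.χ (M.ract (M.lact h s) g) (M.ract s h) X).hom ≫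
            (act.congr (M.ract_mul s g h).symm X).hom) ⊗ₘ (act.χ g h Y).hom) ≫
        (J (g * h) s X Y hY).hom
  /-- Compatibility of `φ` with `χ`. -/
  φ_χ : ∀ g h : G,
    (φ g).hom ≫ (act.γ g).map (φ h).hom ≫ (act.χ g h (𝟙_ C)).hom = (φ (g * h)).hom
  /-- Compatibility of `J` with `ι`. -/
  J_ι : ∀ (s : Γ) (X Y : C) (hY : grading.mem s Y),
    (((act.ι X).hom ≫ (act.congr (M.ract_one s).symm X).hom) ⊗ₘ (act.ι Y).hom) ≫
        (J 1 s X Y hY).hom =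
      (act.ι (X ⊗ Y)).hom
  /-- Compatibility of `φ` with `ι`. -/
  φ_ι : (act.ι (𝟙_ C)).hom = (φ 1).hom

/-- Formal words in variables from `V`, built from `𝟏`, `⊗` and the `γ(g)`. -/
inductive Word (G : Type*) (V : Type*) where
  | var (i : V) : Word G V
  | unit : Word G V
  | tensor (w w' : Word G V) : Word G V
  | act (g : G) (w : Word G V) : Word G V

/-- The variables of a word, read from left to right. -/
def Word.vars {G V : Type*} : Word G V → List V
  | .var i => [i]
  | .unit => []
  | .tensor w w' => w.vars ++ w'.vars
  | .act _ w => w.vars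

/-- The set `W_n` of `n`-ary words, that is, all formal composites with `n` inputs of the nullary
`𝟏`, the unary `-` and `γ(g)`, and the binary `⊗`: these are the words in which the variables
`0, …, n - 1` occur once each and in this order. -/
def WordOfArity (G : Type*) (n : ℕ) : Type _ :=
  {w : Word G (Fin n) // w.vars = List.finRange n}

section

variable {G Γ : Type*} [Group G] [Group Γ] {M : MatchedPair G Γ}
  {C : Type u} [Category.{v} C] [Preadditive C] [HasFiniteBiproducts C]
  [MonoidalCategory C] [MonoidalPreadditive C]

/-- The object `w((X_i)_i)` of `C`. -/
def Word.eval (S : CrossedStructure M C) {V : Type*} (X : V → C) : Word G V → C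
  | .var i => X i
  | .unit => 𝟙_ C
  | .tensor w w' => w.eval S X ⊗ w'.eval S X
  | .act g w => (S.act.γ g).obj (w.eval S X)

/-- The morphisms `w((X_i)_i) ⟶ w'((X_i)_i)` generated by the components of the structure
isomorphisms. A composite is allowed only along a common intermediate word, not along an
accidental equality of objects of `C`. Closure under `tensor` and `act` is closure under the
application of words. The component of `J` is available as soon as the object denoted by the
second word is homogeneous. -/
inductive IsCanonical (S : CrossedStructure M C) {V : Type*} (X : V → C) :
    (w w' : Word G V) → (w.eval S X ⟶ w'.eval S X) → Prop
  | associator (w₁ w₂ w₃ : Word G V) :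
      IsCanonical S X (.tensor (.tensor w₁ w₂) w₃) (.tensor w₁ (.tensor w₂ w₃))
        (α_ (w₁.eval S X) (w₂.eval S X) (w₃.eval S X)).hom
  | leftUnitor (w : Word G V) :
      IsCanonical S X (.tensor .unit w) w (λ_ (w.eval S X)).hom
  | rightUnitor (w : Word G V) :
      IsCanonical S X (.tensor w .unit) w (ρ_ (w.eval S X)).hom
  | J (g : G) (s : Γ) (w₁ w₂ : Word G V) (h : S.grading.mem s (w₂.eval S X)) :
      IsCanonical S X (.tensor (.act (M.ract s g) w₁) (.act g w₂)) (.act g (.tensor w₁ w₂))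
        (S.J g s (w₁.eval S X) (w₂.eval S X) h).hom
  | φ (g : G) : IsCanonical S X .unit (.act g .unit) (S.φ g).hom
  | χ (g h : G) (w : Word G V) :
      IsCanonical S X (.act g (.act h w)) (.act (g * h) w) (S.act.χ g h (w.eval S X)).hom
  | ι (w : Word G V) : IsCanonical S X w (.act 1 w) (S.act.ι (w.eval S X)).hom
  | id (w : Word G V) : IsCanonical S X w w (𝟙 (w.eval S X))
  | inv {w w' : Word G V} (f : w.eval S X ≅ w'.eval S X) (hf : IsCanonical S X w w' f.hom) :
      IsCanonical S X w' w f.inv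
  | comp {w w' w'' : Word G V} (f : w.eval S X ⟶ w'.eval S X)
      (f' : w'.eval S X ⟶ w''.eval S X) (hf : IsCanonical S X w w' f)
      (hf' : IsCanonical S X w' w'' f') : IsCanonical S X w w'' (f ≫ f')
  | tensor {w₁ w₁' w₂ w₂' : Word G V} (f₁ : w₁.eval S X ⟶ w₁'.eval S X)
      (f₂ : w₂.eval S X ⟶ w₂'.eval S X) (h₁ : IsCanonical S X w₁ w₁' f₁)
      (h₂ : IsCanonical S X w₂ w₂' f₂) :
      IsCanonical S X (.tensor w₁ w₂) (.tensor w₁' w₂') (f₁ ⊗ₘ f₂)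
  | act (g : G) {w w' : Word G V} (f : w.eval S X ⟶ w'.eval S X)
      (hf : IsCanonical S X w w' f) :
      IsCanonical S X (.act g w) (.act g w') ((S.act.γ g).map f)

end

end CrossedCoherence

/-! Suppose first that every variable has a degree. A word then has a formal degree and reduces to a
normal word `γ(g₁)x₁ ⊗ (γ(g₂)x₂ ⊗ (⋯ ⊗ 𝟏))`, recorded as a list of pairs `(g, x)`: `γ(g)` is pushed
inside tensor products by `J⁻¹`, twisted by the degree of whatever stands to its right, and is
merged by `χ`. `Word.normalIso` is the resulting isomorphism. The matched pair laws say that source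
and target of each generator have the same normal form, and the coherence axioms say that the
generator becomes the identity there. Induction over lists proves this for concatenation
(`normalTensor_nil_right`, `normalTensor_assoc`) and for the action (`normalActIso_tensor`,
`normalActIso_mul`, `normalActIso_one`). Hence a canonical morphism is determined by its source and
target.

One exception arises: `J` may be used with a degree `s` different from the formal one. The object in
question then lies in two different `C_s`, so it is zero, and equality is trivial.
`IsCanonical.comp_normalIso` carries this alternative through the induction.

For arbitrary objects, each variable is decomposed into homogeneous summands. A word in which every
variable occurs exactly once is multiadditive, so the identity of its value is a sum over choices of
summands. By `IsCanonical.exists_restrict`, canonical morphisms restrict to canonical morphisms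
between the values at the summands, where the homogeneous case applies. -/

namespace CrossedCoherence

/-! ### Combinatorics of normal forms over a matched pair -/

namespace MatchedPair

variable {G Γ V : Type*} [Group G] [Group Γ] (M : MatchedPair G Γ) (d : V → Γ)

/-- The degree of the normal word `γ(g₁)x₁ ⊗ (γ(g₂)x₂ ⊗ ⋯)`, where `x` has degree `d x`. -/
def normalDeg : List (G × V) → Γ
  | [] => 1
  | x :: l => M.lact x.1 (d x.2) * normalDeg l

/-- The normal form of `γ(g)` applied to a normal word. -/
def normalAct (g : G) : List (G × V) → List (G × V)
  | [] => []
  | x :: l => (M.ract (normalDeg M d l) g * x.1, x.2) :: normalAct g l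

theorem normalDeg_append (l m : List (G × V)) :
    M.normalDeg d (l ++ m) = M.normalDeg d l * M.normalDeg d m := by
  induction l with
  | nil => simp [normalDeg]
  | cons x l ih => simp [normalDeg, ih, mul_assoc]

theorem normalDeg_normalAct (g : G) (l : List (G × V)) :
    M.normalDeg d (M.normalAct d g l) = M.lact g (M.normalDeg d l) := by
  induction l with
  | nil => simp [normalDeg, normalAct, M.lact_one]
  | cons x l ih => simp [normalDeg, normalAct, ih, M.lact_mul, M.mul_lact]

/-- Source and target of `J` have the same normal form; the laws `normalAct_mul` and `normalAct_one`
below do the same for `χ` and `ι`. -/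
theorem normalAct_append (g : G) (l m : List (G × V)) :
    M.normalAct d (M.ract (M.normalDeg d m) g) l ++ M.normalAct d g m =
      M.normalAct d g (l ++ m) := by
  induction l with
  | nil => simp [normalAct]
  | cons x l ih => simp [normalAct, ih, normalDeg_append, M.mul_ract]

theorem normalAct_mul (g h : G) (l : List (G × V)) :
    M.normalAct d g (M.normalAct d h l) = M.normalAct d (g * h) l := by
  induction l with
  | nil => simp [normalAct]
  | cons x l ih => simp [normalAct, ih, normalDeg_normalAct, M.ract_mul, mul_assoc]

theorem normalAct_one (l : List (G × V)) : M.normalAct d 1 l = l := by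
  induction l with
  | nil => simp [normalAct]
  | cons x l ih => simp [normalAct, ih, M.ract_one]

/-- The normal form of a word. -/
def normalForm : Word G V → List (G × V)
  | .var i => [(1, i)]
  | .unit => []
  | .tensor w w' => normalForm w ++ normalForm w'
  | .act g w => M.normalAct d g (normalForm w)

end MatchedPair

/-! ### Monoidal identities behind the inductions on normal words -/

section

variable {C : Type u} [Category.{v} C] [MonoidalCategory C]

/-- In this and the following step lemmas `L`, or `γ(h)X`, is the first letter of a normal word, and
the data of the tail are replaced by arbitrary objects and morphisms. This keeps transports along
equal lists out of the computation. -/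
theorem rightUnitor_step {L a b : C} (f : a ⊗ 𝟙_ C ⟶ b) (k : b ⟶ a) (h : f ≫ k = (ρ_ a).hom) :
    ((α_ L a (𝟙_ C)).hom ≫ L ◁ f) ≫ (𝟙 L ⊗ₘ k) = (ρ_ (L ⊗ a)).hom := by
  rw [id_tensorHom, Category.assoc, ← whiskerLeft_comp, h, rightUnitor_tensor_hom]

theorem associator_step {L a b c ab bc abc abc' : C} (f : a ⊗ b ⟶ ab) (f₁ : ab ⊗ c ⟶ abc)
    (k : abc ⟶ abc') (f' : b ⊗ c ⟶ bc) (f₁' : a ⊗ bc ⟶ abc')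
    (h : f ▷ c ≫ f₁ ≫ k = (α_ a b c).hom ≫ a ◁ f' ≫ f₁') :
    (((α_ L a b).hom ≫ L ◁ f) ▷ c) ≫ ((α_ L ab c).hom ≫ L ◁ f₁) ≫ (𝟙 L ⊗ₘ k) =
      (α_ (L ⊗ a) b c).hom ≫ ((L ⊗ a) ◁ f') ≫ ((α_ L a bc).hom ≫ L ◁ f₁') := by
  have h' := congrArg (fun q => L ◁ q) h
  simp only [whiskerLeft_comp] at h'
  rw [id_tensorHom]
  simp only [comp_whiskerRight, Category.assoc, associator_naturality_middle_assoc, h',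
    associator_naturality_right_assoc, pentagon_assoc]

theorem leftUnitor_associator {b c bc : C} (f : b ⊗ c ⟶ bc) :
    (λ_ b).hom ▷ c ≫ f ≫ 𝟙 bc = (α_ (𝟙_ C) b c).hom ≫ 𝟙_ C ◁ f ≫ (λ_ bc).hom := by
  simp

end

section

variable {G Γ : Type*} [Group G] [Group Γ] {M : MatchedPair G Γ}
  {C : Type u} [Category.{v} C] [Preadditive C]

section GroupAction

variable (A : GroupAction G C)

@[simp]
theorem GroupAction.congr_rfl (g : G) (X : C) : A.congr (rfl : g = g) X = Iso.refl _ := rfl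

theorem GroupAction.congr_trans {g h k : G} (e : g = h) (e' : h = k) (X : C) :
    (A.congr e X).hom ≫ (A.congr e' X).hom = (A.congr (e.trans e') X).hom := by
  subst e e'; simp

theorem GroupAction.congr_χ {g g' : G} (e : g = g') (h : G) (X : C) :
    (A.congr e ((A.γ h).obj X)).hom ≫ (A.χ g' h X).hom =
      (A.χ g h X).hom ≫ (A.congr (congrArg (· * h) e) X).hom := by
  subst e; simp

theorem GroupAction.χ_assoc_congr (g h k : G) (X : C) :
    (A.χ g h ((A.γ k).obj X)).hom ≫ (A.χ (g * h) k X).hom =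
      (A.γ g).map (A.χ h k X).hom ≫ (A.χ g (h * k) X).hom ≫
        (A.congr (mul_assoc g h k).symm X).hom :=
  A.χ_assoc g h k X

theorem GroupAction.ι_χ_congr (g : G) (X : C) :
    (A.ι ((A.γ g).obj X)).hom ≫ (A.χ 1 g X).hom = (A.congr (one_mul g).symm X).hom :=
  A.ι_χ g X

end GroupAction

variable [HasFiniteBiproducts C] [MonoidalCategory C] [MonoidalPreadditive C]
  (S : CrossedStructure M C)

/-! ### Induction steps and base cases for the action on normal words -/

section Steps

variable {S}

/-- After precomposing with the invertible `J` of the left factor, `J_assoc` trades the two ways of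
distributing `γ(g)` over a triple product, naturality of `J` moves `f` across, and `ih` handles the
tail. The degree `r` is a free variable because the degree of a concatenation is a product only
propositionally. -/
theorem J_step (g h : G) {s t r : Γ} (X : C) {a b ab a' b' ab' c' : C}
    (ha : S.grading.mem t a) (hb : S.grading.mem s b) (hab : S.grading.mem r ab)
    (hr : t * s = r) (βa : (S.act.γ (M.ract s g)).obj a ⟶ a') (βb : (S.act.γ g).obj b ⟶ b')
    (βab : (S.act.γ g).obj ab ⟶ ab') (f : a ⊗ b ⟶ ab) (f' : a' ⊗ b' ⟶ c') (k : c' ⟶ ab')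
    (ih : (βa ⊗ₘ βb) ≫ f' ≫ k = (S.J g s a b hb).hom ≫ (S.act.γ g).map f ≫ βab)
    (e : M.ract t (M.ract s g) * h = M.ract r g * h)
    {κ : (S.act.γ (M.ract t (M.ract s g) * h)).obj X ⊗ c' ⟶
      (S.act.γ (M.ract r g * h)).obj X ⊗ ab'} (hκ : κ = ((S.act.congr e X).hom ⊗ₘ k)) :
    (((S.J (M.ract s g) t ((S.act.γ h).obj X) a ha).inv ≫
        ((S.act.χ (M.ract t (M.ract s g)) h X).hom ⊗ₘ βa)) ⊗ₘ βb) ≫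
          ((α_ _ _ _).hom ≫ _ ◁ f') ≫ κ =
      (S.J g s ((S.act.γ h).obj X ⊗ a) b hb).hom ≫
        (S.act.γ g).map ((α_ _ _ _).hom ≫ _ ◁ f) ≫
          (S.J g r ((S.act.γ h).obj X) ab hab).inv ≫
            ((S.act.χ (M.ract r g) h X).hom ⊗ₘ βab) := by
  subst hr hκ
  rw [← cancel_epi ((S.J (M.ract s g) t ((S.act.γ h).obj X) a ha).hom ▷ (S.act.γ g).obj b)]
  have hJ := S.J_assoc g t s ((S.act.γ h).obj X) a b ha hb
  have hn := S.J_naturality g (t * s) (S.grading.mem_tensor ha hb) hab (𝟙 ((S.act.γ h).obj X)) f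
  rw [id_tensorHom] at hn
  simp only [Functor.map_comp, Category.assoc, reassoc_of% hJ]
  rw [← reassoc_of% hn, Iso.hom_inv_id_assoc, tensorHom_comp_tensorHom_assoc,
    tensorHom_comp_tensorHom, Category.assoc, Category.assoc, ← ih, (S.act.γ _).map_id,
    Category.id_comp,
    GroupAction.congr_χ, ← tensorHom_id, tensorHom_comp_tensorHom_assoc, Category.id_comp,
    Iso.hom_inv_id_assoc, ← id_tensorHom, tensorHom_comp_tensorHom, associator_naturality_assoc,
    tensorHom_comp_tensorHom, Category.id_comp]

/-- `J_χ` reduces the claim to the two tensor factors: associativity of `χ` settles the first letter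
and `ih` the tail. -/
theorem χ_step (g h k : G) {s r : Γ} (X : C) {a a₁ a₂ a₃ : C}
    (ha : S.grading.mem s a) (ha₁ : S.grading.mem r a₁) (hr : M.lact h s = r)
    (β : (S.act.γ h).obj a ⟶ a₁) (β₁ : (S.act.γ g).obj a₁ ⟶ a₂)
    (β₂ : (S.act.γ (g * h)).obj a ⟶ a₃) (κ : a₂ ⟶ a₃)
    (ih : (S.act.γ g).map β ≫ β₁ ≫ κ = (S.act.χ g h a).hom ≫ β₂)
    (e : M.ract r g * (M.ract s h * k) = M.ract s (g * h) * k)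
    {κ' : (S.act.γ (M.ract r g * (M.ract s h * k))).obj X ⊗ a₂ ⟶
      (S.act.γ (M.ract s (g * h) * k)).obj X ⊗ a₃} (hκ : κ' = ((S.act.congr e X).hom ⊗ₘ κ)) :
    (S.act.γ g).map ((S.J h s ((S.act.γ k).obj X) a ha).inv ≫
        ((S.act.χ (M.ract s h) k X).hom ⊗ₘ β)) ≫
      ((S.J g r ((S.act.γ (M.ract s h * k)).obj X) a₁ ha₁).inv ≫
        ((S.act.χ (M.ract r g) (M.ract s h * k) X).hom ⊗ₘ β₁)) ≫
      κ' =
    (S.act.χ g h ((S.act.γ k).obj X ⊗ a)).hom ≫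
      (S.J (g * h) s ((S.act.γ k).obj X) a ha).inv ≫
        ((S.act.χ (M.ract s (g * h)) k X).hom ⊗ₘ β₂) := by
  subst hr hκ
  rw [← cancel_epi ((S.act.γ g).map (S.J h s ((S.act.γ k).obj X) a ha).hom),
    ← cancel_epi (S.J g (M.lact h s) _ _ (S.mem_act h ha)).hom]
  have hJ := S.J_χ g h s ((S.act.γ k).obj X) a ha
  have hn := S.J_naturality g (M.lact h s) (S.mem_act h ha) ha₁
    (S.act.χ (M.ract s h) k X).hom β
  simp only [reassoc_of% hJ]
  rw [← Functor.map_comp_assoc, Iso.hom_inv_id_assoc, Category.assoc, reassoc_of% hn.symm,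
    Iso.hom_inv_id_assoc, Iso.hom_inv_id_assoc, tensorHom_comp_tensorHom,
    tensorHom_comp_tensorHom, tensorHom_comp_tensorHom, ih, Category.assoc,
    GroupAction.congr_χ]
  congr 1
  rw [reassoc_of% S.act.χ_assoc_congr, GroupAction.congr_trans]

theorem ι_step (k : G) {s : Γ} (X : C) {a a₁ : C} (ha : S.grading.mem s a)
    (β : (S.act.γ 1).obj a ⟶ a₁) (κ : a₁ ⟶ a) (ih : (S.act.ι a).hom ≫ β ≫ κ = 𝟙 a)
    (e : M.ract s 1 * k = k) {κ' : (S.act.γ (M.ract s 1 * k)).obj X ⊗ a₁ ⟶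
      (S.act.γ k).obj X ⊗ a} (hκ : κ' = ((S.act.congr e X).hom ⊗ₘ κ)) :
    (S.act.ι ((S.act.γ k).obj X ⊗ a)).hom ≫
      ((S.J 1 s ((S.act.γ k).obj X) a ha).inv ≫ ((S.act.χ (M.ract s 1) k X).hom ⊗ₘ β)) ≫
        κ' = 𝟙 _ := by
  subst hκ
  rw [← S.J_ι s _ _ ha, Category.assoc, Category.assoc, Iso.hom_inv_id_assoc,
    tensorHom_comp_tensorHom, tensorHom_comp_tensorHom, ih, Category.assoc,
    reassoc_of% GroupAction.congr_χ, GroupAction.congr_trans]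
  rw [reassoc_of% S.act.ι_χ_congr, GroupAction.congr_trans, GroupAction.congr_rfl, Iso.refl_hom,
    id_tensorHom_id]

theorem J_unit_base (g : G) {s : Γ} {b b' : C} (hb : S.grading.mem s b)
    (β : (S.act.γ g).obj b ⟶ b') :
    ((S.φ (M.ract s g)).inv ⊗ₘ β) ≫ (λ_ b').hom ≫ 𝟙 b' =
      (S.J g s (𝟙_ C) b hb).hom ≫ (S.act.γ g).map (λ_ b).hom ≫ β := by
  rw [← cancel_epi ((S.φ (M.ract s g)).hom ▷ (S.act.γ g).obj b),
    reassoc_of% S.J_unit_left g s b hb]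
  rw [← tensorHom_id, tensorHom_comp_tensorHom_assoc]
  simp

theorem χ_unit_base (g h : G) :
    (S.act.γ g).map (S.φ h).inv ≫ (S.φ g).inv ≫ 𝟙 (𝟙_ C) =
      (S.act.χ g h (𝟙_ C)).hom ≫ (S.φ (g * h)).inv := by
  rw [← cancel_epi ((S.act.γ g).map (S.φ h).hom), ← cancel_epi (S.φ g).hom,
    reassoc_of% S.φ_χ g h, ← Functor.map_comp_assoc]
  simp

theorem ι_unit_base : (S.act.ι (𝟙_ C)).hom ≫ (S.φ 1).inv ≫ 𝟙 (𝟙_ C) = 𝟙 (𝟙_ C) := by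
  rw [S.φ_ι]; simp

end Steps

/-! ### Values of normal words, their concatenation and the action on them -/

variable {V : Type*} (Y : V → C)

/-- The value of a normal word. -/
def normalEval : List (G × V) → C
  | [] => 𝟙_ C
  | x :: l => (S.act.γ x.1).obj (Y x.2) ⊗ normalEval l

/-- The identification of the values of equal normal words. -/
def normalCongr {l l' : List (G × V)} (h : l = l') : normalEval S Y l ⟶ normalEval S Y l' :=
  eqToHom (congrArg (normalEval S Y) h)

@[simp]
theorem normalCongr_rfl (l : List (G × V)) :
    normalCongr S Y (rfl : l = l) = 𝟙 (normalEval S Y l) := rfl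

@[simp]
theorem normalCongr_trans {l l' l'' : List (G × V)} (h : l = l') (h' : l' = l'') :
    normalCongr S Y h ≫ normalCongr S Y h' = normalCongr S Y (h.trans h') := by
  subst h h'; simp

/-- Splits a transport into first letter and tail, the form in which the step lemmas consume it. -/
theorem normalCongr_cons {g g' : G} (i : V) {l l' : List (G × V)} (hg : g = g') (hl : l = l')
    (h : (g, i) :: l = (g', i) :: l') :
    normalCongr S Y h = ((S.act.congr hg (Y i)).hom ⊗ₘ normalCongr S Y hl) := by
  subst hg hl
  simp only [normalCongr_rfl, GroupAction.congr_rfl, Iso.refl_hom]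
  exact (id_tensorHom_id _ _).symm

/-- Concatenation of normal words. -/
def normalTensor : (l m : List (G × V)) →
    (normalEval S Y l ⊗ normalEval S Y m ≅ normalEval S Y (l ++ m))
  | [], m => λ_ (normalEval S Y m)
  | x :: l, m => (α_ _ _ _) ≪≫
      whiskerLeftIso ((S.act.γ x.1).obj (Y x.2)) (normalTensor l m)

theorem normalTensor_cons (x : G × V) (l m : List (G × V)) :
    (normalTensor S Y (x :: l) m).hom = (α_ ((S.act.γ x.1).obj (Y x.2)) _ _).hom ≫
      (S.act.γ x.1).obj (Y x.2) ◁ (normalTensor S Y l m).hom := rfl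

theorem normalTensor_congr {l l' m m' : List (G × V)} (h : l = l') (h' : m = m') :
    (normalCongr S Y h ⊗ₘ normalCongr S Y h') ≫ (normalTensor S Y l' m').hom =
      (normalTensor S Y l m).hom ≫ normalCongr S Y (congrArg₂ (· ++ ·) h h') := by
  subst h h'; simp

theorem normalTensor_nil_right (l : List (G × V)) :
    (normalTensor S Y l []).hom ≫ normalCongr S Y l.append_nil =
      (ρ_ (normalEval S Y l)).hom := by
  induction l with
  | nil => exact (Category.comp_id _).trans unitors_equal
  | cons x l ih =>
    rw [normalTensor_cons, normalCongr_cons S Y x.2 rfl l.append_nil]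
    exact rightUnitor_step _ _ ih

theorem normalTensor_assoc (l m k : List (G × V)) :
    ((normalTensor S Y l m).hom ▷ normalEval S Y k) ≫ (normalTensor S Y (l ++ m) k).hom ≫
        normalCongr S Y (List.append_assoc l m k) =
      (α_ _ _ _).hom ≫ (normalEval S Y l ◁ (normalTensor S Y m k).hom) ≫
        (normalTensor S Y l (m ++ k)).hom := by
  induction l with
  | nil => exact leftUnitor_associator _
  | cons x l ih =>
    rw [normalCongr_cons S Y x.2 rfl (List.append_assoc l m k)]
    exact associator_step _ _ _ _ _ ih

section

variable {S} {Y} {d : V → Γ} (hY : ∀ i, S.grading.mem (d i) (Y i))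
include hY

theorem mem_normalEval (l : List (G × V)) :
    S.grading.mem (M.normalDeg d l) (normalEval S Y l) := by
  induction l with
  | nil => exact S.grading.mem_unit
  | cons x l ih => exact S.grading.mem_tensor (S.mem_act x.1 (hY x.2)) ih

/-- The action of `γ(g)` on normal words. -/
def normalActIso (g : G) : (l : List (G × V)) →
    ((S.act.γ g).obj (normalEval S Y l) ≅ normalEval S Y (M.normalAct d g l))
  | [] => (S.φ g).symm
  | x :: l =>
    (S.J g (M.normalDeg d l) ((S.act.γ x.1).obj (Y x.2)) (normalEval S Y l)
      (mem_normalEval hY l)).symm ≪≫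
    tensorIso (S.act.χ (M.ract (M.normalDeg d l) g) x.1 (Y x.2)) (normalActIso g l)

theorem normalActIso_congr (g : G) {l l' : List (G × V)} (h : l = l') :
    (S.act.γ g).map (normalCongr S Y h) ≫ (normalActIso hY g l').hom =
      (normalActIso hY g l).hom ≫ normalCongr S Y (congrArg (M.normalAct d g) h) := by
  subst h; simp

theorem normalActIso_tensor (g : G) (l m : List (G × V)) :
    ((normalActIso hY (M.ract (M.normalDeg d m) g) l).hom ⊗ₘ (normalActIso hY g m).hom) ≫
        (normalTensor S Y _ _).hom ≫ normalCongr S Y (M.normalAct_append d g l m) =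
      (S.J g (M.normalDeg d m) _ _ (mem_normalEval hY m)).hom ≫
        (S.act.γ g).map (normalTensor S Y l m).hom ≫ (normalActIso hY g (l ++ m)).hom := by
  induction l with
  | nil =>
    exact J_unit_base _ _ _
  | cons x l ih =>
    have e : M.ract (M.normalDeg d l) (M.ract (M.normalDeg d m) g) =
        M.ract (M.normalDeg d (l ++ m)) g := by rw [M.normalDeg_append, M.mul_ract]
    exact J_step _ _ _ _ _ _ (M.normalDeg_append d l m).symm _ _ _ _ _ _ ih _
      (normalCongr_cons S Y x.2 (congrArg (· * x.1) e) _ _)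

theorem normalActIso_mul (g h : G) (l : List (G × V)) :
    (S.act.γ g).map (normalActIso hY h l).hom ≫ (normalActIso hY g _).hom ≫
        normalCongr S Y (M.normalAct_mul d g h l) =
      (S.act.χ g h _).hom ≫ (normalActIso hY (g * h) l).hom := by
  induction l with
  | nil =>
    exact χ_unit_base _ _
  | cons x l ih =>
    have e : M.ract (M.normalDeg d (M.normalAct d h l)) g * (M.ract (M.normalDeg d l) h * x.1) =
        M.ract (M.normalDeg d l) (g * h) * x.1 := by
      rw [M.normalDeg_normalAct, M.ract_mul, mul_assoc]
    exact χ_step _ _ _ _ _ _ (M.normalDeg_normalAct d h l).symm _ _ _ _ ih _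
      (normalCongr_cons S Y x.2 e _ _)

theorem normalActIso_one (l : List (G × V)) :
    (S.act.ι _).hom ≫ (normalActIso hY 1 l).hom ≫ normalCongr S Y (M.normalAct_one d l) =
      𝟙 (normalEval S Y l) := by
  induction l with
  | nil =>
    exact ι_unit_base
  | cons x l ih =>
    have e : M.ract (M.normalDeg d l) 1 * x.1 = x.1 := by rw [M.ract_one, one_mul]
    exact ι_step _ _ _ _ _ ih _ (normalCongr_cons S Y x.2 e _ _)

end

end

theorem map_comm_sq {C : Type u} [Category.{v} C] (F : C ⥤ C) {a b a' b' : C}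
    {f : a ⟶ b} {u : a ⟶ a'} {u' : b ⟶ b'}
    {k : a' ⟶ b'} (e : f ≫ u' = u ≫ k) :
    F.map f ≫ F.map u' = F.map u ≫ F.map k := by
  rw [← F.map_comp, e, F.map_comp]

/-! ### Additivity of the tensor product and zero objects -/

section

variable {C : Type u} [Category.{v} C] [Preadditive C] [MonoidalCategory C]
  [MonoidalPreadditive C]

theorem tensor_add_left {a b a' b' : C} (f g : a ⟶ b) (h : a' ⟶ b') :
    (f + g) ⊗ₘ h = f ⊗ₘ h + g ⊗ₘ h := by
  simp only [MonoidalCategory.tensorHom_def, MonoidalPreadditive.add_whiskerRight,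
    Preadditive.add_comp]

theorem tensor_add_right {a b a' b' : C} (f : a ⟶ b) (g h : a' ⟶ b') :
    f ⊗ₘ (g + h) = f ⊗ₘ g + f ⊗ₘ h := by
  simp only [MonoidalCategory.tensorHom_def, MonoidalPreadditive.whiskerLeft_add,
    Preadditive.comp_add]

theorem isZero_tensor_left {X : C} (hX : IsZero X) (Z : C) : IsZero (X ⊗ Z) := by
  rw [IsZero.iff_id_eq_zero] at hX ⊢
  rw [← id_whiskerRight, hX, MonoidalPreadditive.zero_whiskerRight]

theorem isZero_tensor_right {X : C} (hX : IsZero X) (Z : C) : IsZero (Z ⊗ X) := by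
  rw [IsZero.iff_id_eq_zero] at hX ⊢
  rw [← whiskerLeft_id, hX, MonoidalPreadditive.whiskerLeft_zero]

end

/-! ### From normal words to arbitrary words, by naturality -/

section Compat

variable {C : Type u} [Category.{v} C] [MonoidalCategory C]

theorem associator_compat {a b c a' b' c' ab bc abc abc' : C} (u : a ⟶ a') (v : b ⟶ b')
    (w : c ⟶ c') (f : a' ⊗ b' ⟶ ab) (f₁ : ab ⊗ c' ⟶ abc) (k : abc ⟶ abc')
    (f' : b' ⊗ c' ⟶ bc) (f₁' : a' ⊗ bc ⟶ abc')
    (h : f ▷ c' ≫ f₁ ≫ k = (α_ a' b' c').hom ≫ a' ◁ f' ≫ f₁') :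
    (α_ a b c).hom ≫ (u ⊗ₘ ((v ⊗ₘ w) ≫ f')) ≫ f₁' =
      ((((u ⊗ₘ v) ≫ f) ⊗ₘ w) ≫ f₁) ≫ k := by
  have h₁ : (((u ⊗ₘ v) ≫ f) ⊗ₘ w) = ((u ⊗ₘ v) ⊗ₘ w) ≫ f ▷ c' := by
    rw [← tensorHom_id, tensorHom_comp_tensorHom, Category.comp_id]
  have h₂ : (u ⊗ₘ ((v ⊗ₘ w) ≫ f')) = (u ⊗ₘ (v ⊗ₘ w)) ≫ a' ◁ f' := by
    rw [← id_tensorHom, tensorHom_comp_tensorHom, Category.comp_id]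
  rw [h₁, h₂, Category.assoc, Category.assoc, Category.assoc, h, associator_naturality_assoc]

theorem rightUnitor_compat {a a' b : C} (u : a ⟶ a') (f : a' ⊗ 𝟙_ C ⟶ b) (k : b ⟶ a')
    (h : f ≫ k = (ρ_ a').hom) :
    (ρ_ a).hom ≫ u = ((u ⊗ₘ 𝟙 (𝟙_ C)) ≫ f) ≫ k := by
  rw [Category.assoc, h, tensorHom_id, rightUnitor_naturality]

theorem leftUnitor_compat {a a' : C} (u : a ⟶ a') :
    (λ_ a).hom ≫ u = ((𝟙 (𝟙_ C) ⊗ₘ u) ≫ (λ_ a').hom) ≫ 𝟙 a' := by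
  simp

theorem tensor_compat {a a₁ b b₁ a' a₁' b' b₁' c c' : C} {f : a ⟶ b} {u : a ⟶ a'} {u' : b ⟶ b'}
    {k : a' ⟶ b'} {f₁ : a₁ ⟶ b₁} {u₁ : a₁ ⟶ a₁'} {u₁' : b₁ ⟶ b₁'} {k₁ : a₁' ⟶ b₁'}
    {A : a' ⊗ a₁' ⟶ c} {A' : b' ⊗ b₁' ⟶ c'} {κ : c ⟶ c'} (e : f ≫ u' = u ≫ k)
    (e₁ : f₁ ≫ u₁' = u₁ ≫ k₁) (h : (k ⊗ₘ k₁) ≫ A' = A ≫ κ) :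
    (f ⊗ₘ f₁) ≫ (u' ⊗ₘ u₁') ≫ A' = ((u ⊗ₘ u₁) ≫ A) ≫ κ := by
  rw [tensorHom_comp_tensorHom_assoc, e, e₁, ← tensorHom_comp_tensorHom_assoc, h,
    Category.assoc]

theorem tensorHom_comm_sq {a a₁ b b₁ a' a₁' b' b₁' : C} {f : a ⟶ b} {u : a ⟶ a'} {u' : b ⟶ b'}
    {k : a' ⟶ b'} {f₁ : a₁ ⟶ b₁} {u₁ : a₁ ⟶ a₁'} {u₁' : b₁ ⟶ b₁'} {k₁ : a₁' ⟶ b₁'}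
    (e : f ≫ u' = u ≫ k) (e₁ : f₁ ≫ u₁' = u₁ ≫ k₁) :
    (f ⊗ₘ f₁) ≫ (u' ⊗ₘ u₁') = (u ⊗ₘ u₁) ≫ (k ⊗ₘ k₁) := by
  rw [tensorHom_comp_tensorHom, e, e₁, tensorHom_comp_tensorHom]

end Compat

section

variable {G Γ : Type*} [Group G] {C : Type u} [Category.{v} C] [Preadditive C]

theorem GroupAction.isZero_obj (A : GroupAction G C) (g : G) {X : C} (hX : IsZero X) :
    IsZero ((A.γ g).obj X) := by
  have := A.additive g
  exact Functor.map_isZero _ hX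

variable [HasFiniteBiproducts C]

theorem Grading.isZero_of_mem {P : Grading Γ C} {s t : Γ} (h : s ≠ t) {X : C} (hs : P.mem s X)
    (ht : P.mem t X) : IsZero X :=
  (IsZero.iff_id_eq_zero X).2 (P.hom_eq_zero h hs ht _)

/-- If the degrees differ, the inclusion vanishes, so the retract is zero, and a zero object belongs
to every `C_s`. -/
theorem Grading.mem_of_retract {P : Grading Γ C} {s t : Γ} {X Y : C} (p : Y ⟶ X) (q : X ⟶ Y)
    (h : p ≫ q = 𝟙 Y) (hX : P.mem s X) (hY : P.mem t Y) : P.mem s Y := by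
  by_cases hst : t = s
  · exact hst ▸ hY
  · refine P.mem_of_isZero s ((IsZero.iff_id_eq_zero Y).2 ?_)
    rw [← h, P.hom_eq_zero hst hY hX p, zero_comp]

end

section

variable {G Γ V : Type*} [Group G] [Group Γ] {M : MatchedPair G Γ}
  {C : Type u} [Category.{v} C] [Preadditive C] [HasFiniteBiproducts C]
  [MonoidalCategory C] [MonoidalPreadditive C] {S : CrossedStructure M C}

theorem J_compat (g : G) {s : Γ} {a b a' b' ab a₁ b₁ c₁ ab₁ : C} (hb : S.grading.mem s b)
    (hb' : S.grading.mem s b') (u : a ⟶ a') (v : b ⟶ b') (f : a' ⊗ b' ⟶ ab)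
    (βa : (S.act.γ (M.ract s g)).obj a' ⟶ a₁) (βb : (S.act.γ g).obj b' ⟶ b₁)
    (βab : (S.act.γ g).obj ab ⟶ ab₁) (A : a₁ ⊗ b₁ ⟶ c₁) (k : c₁ ⟶ ab₁)
    (h : (βa ⊗ₘ βb) ≫ A ≫ k = (S.J g s a' b' hb').hom ≫ (S.act.γ g).map f ≫ βab) :
    (S.J g s a b hb).hom ≫ (S.act.γ g).map ((u ⊗ₘ v) ≫ f) ≫ βab =
      ((((S.act.γ (M.ract s g)).map u ≫ βa) ⊗ₘ ((S.act.γ g).map v ≫ βb)) ≫ A) ≫ k := by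
  rw [← tensorHom_comp_tensorHom, Category.assoc, Category.assoc, h,
    reassoc_of% S.J_naturality g s hb hb' u v, Functor.map_comp, Category.assoc]

theorem χ_compat (g h : G) {a b b₁ b₂ b₃ : C} (u : a ⟶ b) (β : (S.act.γ h).obj b ⟶ b₁)
    (β₁ : (S.act.γ g).obj b₁ ⟶ b₂) (k : b₂ ⟶ b₃) (β' : (S.act.γ (g * h)).obj b ⟶ b₃)
    (e : (S.act.γ g).map β ≫ β₁ ≫ k = (S.act.χ g h b).hom ≫ β') :
    (S.act.χ g h a).hom ≫ (S.act.γ (g * h)).map u ≫ β' =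
      ((S.act.γ g).map ((S.act.γ h).map u ≫ β) ≫ β₁) ≫ k := by
  rw [← reassoc_of% S.act.χ_naturality g h u, Functor.map_comp, Category.assoc, Category.assoc, e]

theorem ι_compat {a b c : C} (u : a ⟶ b) (β : (S.act.γ 1).obj b ⟶ c) (k : c ⟶ b) (k' : b ⟶ c)
    (e : (S.act.ι b).hom ≫ β ≫ k = 𝟙 b) (hk : k ≫ k' = 𝟙 c) :
    (S.act.ι a).hom ≫ (S.act.γ 1).map u ≫ β = u ≫ k' := by
  rw [← reassoc_of% S.act.ι_naturality u, ← Category.comp_id β, ← hk, reassoc_of% e]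

theorem φ_compat (g : G) :
    (S.φ g).hom ≫ (S.act.γ g).map (𝟙 (𝟙_ C)) ≫ (S.φ g).inv = 𝟙 (𝟙_ C) ≫ 𝟙 (𝟙_ C) := by
  simp

theorem act_compat {g : G} {a b a' b' c c' : C} {f : a ⟶ b} {u : a ⟶ a'} {u' : b ⟶ b'}
    {k : a' ⟶ b'} {β : (S.act.γ g).obj a' ⟶ c} {β' : (S.act.γ g).obj b' ⟶ c'} {κ : c ⟶ c'}
    (e : f ≫ u' = u ≫ k) (h : (S.act.γ g).map k ≫ β' = β ≫ κ) :
    (S.act.γ g).map f ≫ (S.act.γ g).map u' ≫ β' = ((S.act.γ g).map u ≫ β) ≫ κ := by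
  rw [← Functor.map_comp_assoc, e, Functor.map_comp_assoc, h, Category.assoc]

theorem IsCanonical.isIso {X : V → C} {w w' : Word G V} {f : w.eval S X ⟶ w'.eval S X}
    (hf : IsCanonical S X w w' f) : IsIso f := by
  induction hf with
  | inv f _ _ => infer_instance
  | comp f f' _ _ h h' => exact IsIso.comp_isIso' h h'
  | tensor f f' _ _ h h' => exact inferInstanceAs (IsIso (f ⊗ₘ f'))
  | act g f _ h => exact Functor.map_isIso _ f
  | id => exact IsIso.id _
  | _ => exact Iso.isIso_hom _

/-! ### Coherence for homogeneous objects -/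

section Homogeneous

variable {Y : V → C} {d : V → Γ} (hY : ∀ i, S.grading.mem (d i) (Y i))

/-- The isomorphism of the value of a word with the value of its normal form. -/
def Word.normalIso : (w : Word G V) → (w.eval S Y ≅ normalEval S Y (M.normalForm d w))
  | .var i => S.act.ι (Y i) ≪≫ (ρ_ _).symm
  | .unit => Iso.refl _
  | .tensor w w' => tensorIso w.normalIso w'.normalIso ≪≫ normalTensor S Y _ _
  | .act g w => (S.act.γ g).mapIso w.normalIso ≪≫ normalActIso hY g _

include hY in
theorem Word.mem_eval (w : Word G V) :
    S.grading.mem (M.normalDeg d (M.normalForm d w)) (w.eval S Y) :=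
  S.grading.mem_of_iso (w.normalIso hY).symm (mem_normalEval hY _)

theorem Word.normalIso_tensor (w w' : Word G V) :
    ((Word.tensor w w').normalIso hY).hom =
      ((w.normalIso hY).hom ⊗ₘ (w'.normalIso hY).hom) ≫ (normalTensor S Y _ _).hom := rfl

theorem Word.normalIso_act (g : G) (w : Word G V) :
    ((Word.act g w).normalIso hY).hom =
      (S.act.γ g).map (w.normalIso hY).hom ≫ (normalActIso hY g _).hom := rfl

theorem Word.normalIso_associator (w₁ w₂ w₃ : Word G V) :
    (α_ (w₁.eval S Y) (w₂.eval S Y) (w₃.eval S Y)).hom ≫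
        ((Word.tensor w₁ (.tensor w₂ w₃)).normalIso hY).hom =
      ((Word.tensor (.tensor w₁ w₂) w₃).normalIso hY).hom ≫
        normalCongr S Y (List.append_assoc _ _ _) :=
  associator_compat _ _ _ _ _ _ _ _ (normalTensor_assoc S Y _ _ _)

theorem Word.normalIso_rightUnitor (w : Word G V) :
    (ρ_ (w.eval S Y)).hom ≫ (w.normalIso hY).hom =
      ((Word.tensor w .unit).normalIso hY).hom ≫ normalCongr S Y (List.append_nil _) :=
  rightUnitor_compat _ _ _ (normalTensor_nil_right S Y _)

theorem Word.normalIso_leftUnitor (w : Word G V) :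
    (λ_ (w.eval S Y)).hom ≫ (w.normalIso hY).hom =
      ((Word.tensor .unit w).normalIso hY).hom ≫ 𝟙 _ :=
  leftUnitor_compat _

theorem Word.normalIso_J (g : G) (w w' : Word G V)
    (h : S.grading.mem (M.normalDeg d (M.normalForm d w')) (w'.eval S Y)) :
    (S.J g _ (w.eval S Y) (w'.eval S Y) h).hom ≫
        ((Word.act g (.tensor w w')).normalIso hY).hom =
      ((Word.tensor (.act (M.ract (M.normalDeg d (M.normalForm d w')) g) w)
        (.act g w')).normalIso hY).hom ≫
        normalCongr S Y (M.normalAct_append d g _ _) :=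
  J_compat _ _ _ _ _ _ _ _ _ _ _ (normalActIso_tensor hY g _ _)

theorem Word.normalIso_χ (g h : G) (w : Word G V) :
    (S.act.χ g h (w.eval S Y)).hom ≫ ((Word.act (g * h) w).normalIso hY).hom =
      ((Word.act g (.act h w)).normalIso hY).hom ≫ normalCongr S Y (M.normalAct_mul d g h _) :=
  χ_compat _ _ _ _ _ _ _ (normalActIso_mul hY g h _)

theorem Word.normalIso_ι (w : Word G V) :
    (S.act.ι (w.eval S Y)).hom ≫ ((Word.act 1 w).normalIso hY).hom =
      (w.normalIso hY).hom ≫ normalCongr S Y (M.normalAct_one d _).symm :=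
  ι_compat _ _ _ _ (normalActIso_one hY _) (normalCongr_trans S Y _ _)

theorem Word.normalIso_φ (g : G) :
    (S.φ g).hom ≫ ((Word.act g .unit).normalIso hY).hom =
      (Word.unit.normalIso hY).hom ≫ 𝟙 _ :=
  φ_compat g

/-- Nonzero values force equal normal forms, and modulo `normalIso` the morphism is then a mere
transport. The zero alternative cannot be dropped, since normal forms may differ when `J` is used
with a degree other than the formal one. -/
theorem IsCanonical.comp_normalIso {w w' : Word G V} {f : w.eval S Y ⟶ w'.eval S Y}
    (hf : IsCanonical S Y w w' f) :
    IsZero (w.eval S Y) ∨ ∃ h : M.normalForm d w = M.normalForm d w',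
      f ≫ (w'.normalIso hY).hom = (w.normalIso hY).hom ≫ normalCongr S Y h := by
  induction hf with
  | associator w₁ w₂ w₃ => exact .inr ⟨_, Word.normalIso_associator hY w₁ w₂ w₃⟩
  | leftUnitor w => exact .inr ⟨rfl, Word.normalIso_leftUnitor hY w⟩
  | rightUnitor w => exact .inr ⟨_, Word.normalIso_rightUnitor hY w⟩
  | J g s w₁ w₂ h =>
    by_cases hs : M.normalDeg d (M.normalForm d w₂) = s
    · subst hs
      exact .inr ⟨_, Word.normalIso_J hY g w₁ w₂ h⟩
    -- The value of `w₂` has both its formal degree and the different degree `s`, so it is zero.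
    · exact .inl (isZero_tensor_right
        (S.act.isZero_obj g (Grading.isZero_of_mem hs (w₂.mem_eval hY) h)) _)
  | φ g => exact .inr ⟨rfl, Word.normalIso_φ hY g⟩
  | χ g h w => exact .inr ⟨_, Word.normalIso_χ hY g h w⟩
  | ι w => exact .inr ⟨_, Word.normalIso_ι hY w⟩
  | id w => exact .inr ⟨rfl, by simp⟩
  | inv f _ ih =>
    rcases ih with h | ⟨h, e⟩
    · exact .inl (h.of_iso f.symm)
    · refine .inr ⟨h.symm, ?_⟩
      rw [Iso.inv_comp_eq, reassoc_of% e]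
      simp
  | comp f f' hf _ ih ih' =>
    rcases ih with h | ⟨h, e⟩
    · exact .inl h
    rcases ih' with h' | ⟨h', e'⟩
    -- Only the intermediate value is known to be zero; it is isomorphic to the source through `f`.
    · have := hf.isIso
      exact .inl (h'.of_iso (asIso f))
    · exact .inr ⟨h.trans h', by rw [Category.assoc, e', reassoc_of% e]; simp⟩
  | tensor f₁ f₂ _ _ ih₁ ih₂ =>
    rcases ih₁ with h₁ | ⟨h₁, e₁⟩
    · exact .inl (isZero_tensor_left h₁ _)
    rcases ih₂ with h₂ | ⟨h₂, e₂⟩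
    · exact .inl (isZero_tensor_right h₂ _)
    refine .inr ⟨congrArg₂ (· ++ ·) h₁ h₂, ?_⟩
    rw [Word.normalIso_tensor, Word.normalIso_tensor]
    exact tensor_compat e₁ e₂ (normalTensor_congr S Y h₁ h₂)
  | act g f _ ih =>
    rcases ih with h | ⟨h, e⟩
    · exact .inl (S.act.isZero_obj g h)
    · refine .inr ⟨congrArg (M.normalAct d g) h, ?_⟩
      rw [Word.normalIso_act, Word.normalIso_act]
      exact act_compat e (normalActIso_congr hY g h)

include hY in
/-- Coherence for homogeneous objects. -/
theorem IsCanonical.eq_of_homogeneous {w w' : Word G V} {f f' : w.eval S Y ⟶ w'.eval S Y}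
    (hf : IsCanonical S Y w w' f) (hf' : IsCanonical S Y w w' f') : f = f' := by
  rcases hf.comp_normalIso hY with h | ⟨h, e⟩
  · exact h.eq_of_src f f'
  rcases hf'.comp_normalIso hY with h | ⟨h', e'⟩
  · exact h.eq_of_src f f'
  · rw [← cancel_mono (w'.normalIso hY).hom, e, e']

end Homogeneous

/-! ### Functoriality and multiadditivity of words -/

section Map

variable {X Y Z : V → C}

variable (S) in
/-- The functoriality of words. -/
def Word.map (p : ∀ i, X i ⟶ Y i) : (w : Word G V) → (w.eval S X ⟶ w.eval S Y)
  | .var i => p i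
  | .unit => 𝟙 _
  | .tensor w w' => w.map p ⊗ₘ w'.map p
  | .act g w => (S.act.γ g).map (w.map p)

theorem Word.map_id (w : Word G V) : w.map S (fun i => 𝟙 (X i)) = 𝟙 (w.eval S X) := by
  induction w with
  | var i => rfl
  | unit => rfl
  | tensor w w' h h' => rw [Word.map, h, h']; exact id_tensorHom_id _ _
  | act g w h => rw [Word.map, h]; exact CategoryTheory.Functor.map_id _ _

theorem Word.map_comp (p : ∀ i, X i ⟶ Y i) (q : ∀ i, Y i ⟶ Z i) (w : Word G V) :
    w.map S (fun i => p i ≫ q i) = w.map S p ≫ w.map S q := by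
  induction w with
  | var i => rfl
  | unit => exact (Category.comp_id _).symm
  | tensor w w' h h' => rw [Word.map, h, h']; exact (tensorHom_comp_tensorHom _ _ _ _).symm
  | act g w h => rw [Word.map, h]; exact Functor.map_comp _ _ _

variable [DecidableEq V]

theorem Word.map_update_of_notMem (p : ∀ i, X i ⟶ Y i) {i : V} (a : X i ⟶ Y i) (w : Word G V)
    (hi : i ∉ w.vars) : w.map S (Function.update p i a) = w.map S p := by
  induction w with
  | var j =>
    have : j ≠ i := fun h => hi (by simp [Word.vars, h])
    exact Function.update_of_ne this a p
  | unit => rfl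
  | tensor w w' h h' =>
    simp only [Word.vars, List.mem_append, not_or] at hi
    rw [Word.map, h hi.1, h' hi.2, Word.map]
  | act g w h => rw [Word.map, h hi, Word.map]

theorem Word.map_update_add (p : ∀ i, X i ⟶ Y i) {i : V} (a b : X i ⟶ Y i) (w : Word G V)
    (hw : w.vars.Nodup) (hi : i ∈ w.vars) :
    w.map S (Function.update p i (a + b)) =
      w.map S (Function.update p i a) + w.map S (Function.update p i b) := by
  induction w with
  | var j =>
    obtain rfl : i = j := by simpa [Word.vars] using hi
    simp only [Word.map, Function.update_self]
    rfl
  | unit => simp [Word.vars] at hi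
  | tensor w w' h h' =>
    simp only [Word.vars, List.nodup_append'] at hw
    simp only [Word.map]
    rcases List.mem_append.1 hi with h₁ | h₁
    · have h₂ : i ∉ w'.vars := hw.2.2 h₁
      rw [h hw.1 h₁]
      simp only [map_update_of_notMem _ _ w' h₂]
      exact tensor_add_left _ _ _
    · have h₂ : i ∉ w.vars := fun h₂ => hw.2.2 h₂ h₁
      rw [h' hw.2.1 h₁]
      simp only [map_update_of_notMem _ _ w h₂]
      exact tensor_add_right _ _ _
  | act g w h =>
    have := S.act.additive g
    rw [Word.map, h hw hi]
    exact Functor.map_add _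

/-- A word in which every variable occurs exactly once is multiadditive. -/
def Word.mapMultilinear (X Y : V → C) (w : Word G V) (hw : w.vars.Nodup)
    (hw' : ∀ i, i ∈ w.vars) :
    MultilinearMap ℤ (fun i => X i ⟶ Y i) (w.eval S X ⟶ w.eval S Y) where
  toFun p := w.map S p
  map_update_add' p i a b := by
    rw [← Word.map_update_add p a b w hw (hw' i)]
  map_update_smul' p i c a := by
    have := map_zsmul (AddMonoidHom.mk' (fun a => w.map S (Function.update p i a))
      fun a b => Word.map_update_add p a b w hw (hw' i)) c a
    simp only [AddMonoidHom.mk'_apply] at this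
    rw [← this]

end Map

/-- Every generator is natural in its variables. Only `J` needs more: its component at the summands
must exist in the same degree `s`. The retractions `q` serve this purpose, as the value at `Y` is a
homogeneous retract of an object of `C_s`. -/
theorem IsCanonical.exists_restrict {X Y : V → C} {d : V → Γ}
    (hY : ∀ i, S.grading.mem (d i) (Y i)) (p : ∀ i, Y i ⟶ X i) (q : ∀ i, X i ⟶ Y i)
    (hpq : ∀ i, p i ≫ q i = 𝟙 (Y i)) {w w' : Word G V} {f : w.eval S X ⟶ w'.eval S X}
    (hf : IsCanonical S X w w' f) :
    ∃ f' : w.eval S Y ⟶ w'.eval S Y, IsCanonical S Y w w' f' ∧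
      w.map S p ≫ f = f' ≫ w'.map S p := by
  induction hf with
  | associator w₁ w₂ w₃ => exact ⟨_, .associator w₁ w₂ w₃, associator_naturality _ _ _⟩
  | leftUnitor w => exact ⟨_, .leftUnitor w,
      (congrArg (· ≫ _) (id_tensorHom _ _)).trans (leftUnitor_naturality _)⟩
  | rightUnitor w => exact ⟨_, .rightUnitor w,
      (congrArg (· ≫ _) (tensorHom_id _ _)).trans (rightUnitor_naturality _)⟩
  | J g s w₁ w₂ h =>
    have h' : S.grading.mem s (w₂.eval S Y) := by
      refine Grading.mem_of_retract (w₂.map S p) (w₂.map S q) ?_ h (w₂.mem_eval hY)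
      rw [← Word.map_comp, funext hpq, Word.map_id]
    exact ⟨_, .J g s w₁ w₂ h', S.J_naturality g s h' h _ _⟩
  | φ g => exact ⟨_, .φ g, (Category.id_comp _).trans
      ((congrArg (_ ≫ ·) (CategoryTheory.Functor.map_id _ _)).trans (Category.comp_id _)).symm⟩
  | χ g h w => exact ⟨_, .χ g h w, S.act.χ_naturality g h _⟩
  | ι w => exact ⟨_, .ι w, S.act.ι_naturality _⟩
  | id w => exact ⟨_, .id w, by simp⟩
  | inv f _ ih =>
    obtain ⟨f', hf', e⟩ := ih
    have := hf'.isIso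
    refine ⟨(asIso f').inv, .inv (asIso f') hf', ?_⟩
    rw [asIso_inv, IsIso.eq_inv_comp, ← reassoc_of% e, Iso.hom_inv_id, Category.comp_id]
  | comp f₁ f₂ _ _ ih₁ ih₂ =>
    obtain ⟨f₁', h₁, e₁⟩ := ih₁
    obtain ⟨f₂', h₂, e₂⟩ := ih₂
    exact ⟨_, .comp f₁' f₂' h₁ h₂, by rw [reassoc_of% e₁, e₂, Category.assoc]⟩
  | tensor f₁ f₂ _ _ ih₁ ih₂ =>
    obtain ⟨f₁', h₁, e₁⟩ := ih₁
    obtain ⟨f₂', h₂, e₂⟩ := ih₂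
    exact ⟨_, .tensor f₁' f₂' h₁ h₂, tensorHom_comm_sq e₁ e₂⟩
  | act g f _ ih =>
    obtain ⟨f', h, e⟩ := ih
    exact ⟨_, .act g f' h, map_comm_sq _ e⟩

end

end CrossedCoherence

/-! ### Reduction to homogeneous summands -/

theorem mainTheorem3 {G Γ : Type*} [Group G] [Group Γ]
    (M : CrossedCoherence.MatchedPair G Γ)
    {C : Type u} [Category.{v} C] [Preadditive C] [HasFiniteBiproducts C]
    [MonoidalCategory C] [MonoidalPreadditive C]
    (S : CrossedCoherence.CrossedStructure M C)
    (n : ℕ) (w w' : CrossedCoherence.WordOfArity G n) (X : Fin n → C)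
    (f f' : w.1.eval S X ⟶ w'.1.eval S X)
    (hf : CrossedCoherence.IsCanonical S X w.1 w'.1 f)
    (hf' : CrossedCoherence.IsCanonical S X w.1 w'.1 f') :
    f = f' := by
  choose k d Y hY e using fun i => S.grading.exists_decomposition (X i)
  let p (i : Fin n) (j : Fin (k i)) : Y i j ⟶ X i := biproduct.ι (Y i) j ≫ (e i).some.inv
  let q (i : Fin n) (j : Fin (k i)) : X i ⟶ Y i j := (e i).some.hom ≫ biproduct.π (Y i) j
  have hpq (i j) : p i j ≫ q i j = 𝟙 (Y i j) := by simp [p, q]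
  have hqp (i) : 𝟙 (X i) = ∑ j, q i j ≫ p i j := by
    have h : (e i).some.hom ≫ (∑ j, biproduct.π (Y i) j ≫ biproduct.ι (Y i) j) ≫
        (e i).some.inv = 𝟙 (X i) := by
      rw [biproduct.total]; simp
    rw [← h, Preadditive.sum_comp, Preadditive.comp_sum]
    simp [p, q]
  have hw : w.1.vars.Nodup := by
    rw [w.2]
    exact List.nodup_finRange n
  have hw' (i) : i ∈ w.1.vars := by
    rw [w.2]
    exact List.mem_finRange i
  -- Multilinear expansion of `w` applied to the decompositions `hqp`; `r` selects one summand for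
  -- each variable.
  have hid : 𝟙 (w.1.eval S X) = ∑ r : ∀ i, Fin (k i),
      w.1.map S (fun i => q i (r i)) ≫ w.1.map S (fun i => p i (r i)) := by
    simp only [← CrossedCoherence.Word.map_comp]
    rw [← CrossedCoherence.Word.map_id, funext hqp]
    exact (w.1.mapMultilinear X X hw hw').map_sum fun i j => q i j ≫ p i j
  rw [← Category.id_comp f, ← Category.id_comp f', hid, Preadditive.sum_comp,
    Preadditive.sum_comp]
  refine Finset.sum_congr rfl fun r _ => ?_
  rw [Category.assoc, Category.assoc]
  -- It suffices to compare `f` and `f'` after the inclusion of the chosen summands, where both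
  -- factor through their restrictions.
  congr 1
  have hY' (i) := hY i (r i)
  obtain ⟨f₁, h₁, e₁⟩ := hf.exists_restrict hY' (fun i => p i (r i)) (fun i => q i (r i))
    fun i => hpq i (r i)
  obtain ⟨f₂, h₂, e₂⟩ := hf'.exists_restrict hY' (fun i => p i (r i)) (fun i => q i (r i))
    fun i => hpq i (r i)
  rw [e₁, e₂, h₁.eq_of_homogeneous hY' h₂]
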